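/- **Conventions.** All matrices are integral. A quiver $Q$ has vertices $\{1,\dots,m\}$ and arrows $\{1,\dots,n\}$, each arrow $i$ having a source $s(i)$ and a target $t(i)$. Its incidence matrix $I(Q)$ is the $m\times n$ matrix with $i$-th column $e_{s(i)}-e_{t(i)}$; $\check G_Q$ is the upper triangular matrix with $\check G_Q+\check G_Q^{\top}=I(Q)^{\top}I(Q)$; if $Q$ has no loops, $\check G_Q$ is invertible over $\mathbb Z$ and the Coxeter-Laplacian of $Q$ is $\Lambda_Q=\mathrm{Id}_m-I(Q)\check G_Q^{-1}I(Q)^{\top}$. A walk $w=i_1^{\epsilon_1}\cdots i_l^{\epsilon_l}$ ($\epsilon_t=\pm1$) is a sequence of consecutive arrows, traversed forwards ($+1$) or backwards ($-1$); its incidence vector is $\mathrm{inc}(w)=\sum_t\epsilon_t e_{i_t}\in\mathbb Z^n$; trivial walks (of length $0$) are allowed. The walk $w$ is minimally descending if, for $1\le t<l$, $i_{t+1}$ is the largest arrow $j<i_t$ incident with the target of $i_t^{\epsilon_t}$. A minimally descending walk $w$ is structural if, whenever a concatenation $w'ww''$ is minimally descending, $w'$ and $w''$ are trivial. In a connected loop-less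 quiver with $m\ge 2$ vertices there is exactly one structural walk $\alpha^-_Q(v)$ starting at each vertex $v$; put $a_v^-=\mathrm{inc}(\alpha_Q^-(v))$. The inverse quiver $Q^\dagger$ has the same vertices and arrows as $Q$; in $Q^\dagger$ the target (resp. the source) of an arrow $i$ is the target of the unique structural walk of $Q$ that contains $i^{+1}$ (resp. $i^{-1}$). Let $\pi=(\pi_1\ge\dots\ge\pi_\ell>0)$ be a partition of $m\ge2$ and $d\ge0$; put $v_t=m-(\pi_1+\dots+\pi_t)$. The standard quiver $\vec Q=\vec{\mathbb A}^d[\pi]$ has vertices $1,\dots,m$ and $n=m+\ell+2(d-1)$ arrows, in this order: $i_1,\dots,i_{m-1}$ with $i_t:t\to t+1$; $j_1,\dots,j_{\ell-1}$ with $j_t:v_{t-1}\to v_t$; $k_1,\dots,k_{2d}$, where $k_t$ is antiparallel to $\alpha$ for $t$ odd and parallel to $\alpha$ for $t$ even, with $\alpha=i_{m-1}$ if $\ell=1$ and $\alpha=j_{\ell-1}$ if $\ell>1$. **Proposition.** Let $Q$ be a connected loop-less quiver with $m\ge2$ vertices and $n\ge1$ arrows such that $\Lambda_Q=\Lambda_{\vec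 Q}$ for a standard quiver $\vec Q=\vec{\mathbb A}^d[\pi]$ with the same number of vertices and of arrows as $Q$. Then $I(Q^\dagger)=I(Q)\check G_Q^{-1}$, $I(\vec Q^\dagger)=I(\vec Q)\check G_{\vec Q}^{-1}$, and there is a (not necessarily $\mathbb Z$-invertible) integral $n\times n$ matrix $B$ such that $$I(Q)B=I(\vec Q)\qquad\text{and}\qquad I(\vec Q^\dagger)B^{\top}=I(Q^\dagger).$$ Explicitly, there are walks $\delta(t)$ of $Q$ from $v_t$ to $v_t+1$ for $1\le t\le \ell-1$, and for every choice of such walks, with $d_t=\mathrm{inc}(\delta(t))$ and $y_t=a^-_{v_{t-1}}-d_t$, the matrix $B$ with the following columns satisfies both equations: * for $1\le v\le m-1$, the $v$-th column is $d_t$ if $v=v_t$ for some $1\le t\le\ell-1$, and $a_v^-$ otherwise; * for $1\le t\le\ell-1$, the $(m-1+t)$-th column is $y_t$; * for $1\le t\le 2d$, the $(m+\ell-2+t)$-th column is $(-1)^t z$, where $z=a^-_{m-1}$ if $\ell=1$ and $z=y_{\ell-1}$ if $\ell>1$. -/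

import Mathlib

open scoped Matrix

/-- A finite quiver with vertex set `{1, …, m}` and arrow set `{1, …, n}` (both with their natural
order; `Fin m` and `Fin n` are zero-based, so the vertex labelled `x` is the element `x - 1`). -/
structure FinQuiver (m n : ℕ) where
  src : Fin n → Fin m
  tgt : Fin n → Fin m

namespace FinQuiver

variable {m n : ℕ}

/-- No arrow is a loop. -/
def Loopless (Q : FinQuiver m n) : Prop := ∀ i, Q.src i ≠ Q.tgt i

/-- The incidence matrix: the `i`-th column is `e_{src i} - e_{tgt i}`. -/
def incidence (Q : FinQuiver m n) : Matrix (Fin m) (Fin n) ℤ :=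
  Matrix.of fun v i => (if v = Q.src i then 1 else 0) - (if v = Q.tgt i then 1 else 0)

/-- The symmetric Gram matrix `I(Q)ᵀ I(Q)`. -/
def gram (Q : FinQuiver m n) : Matrix (Fin n) (Fin n) ℤ := Q.incidenceᵀ * Q.incidence

/-- The upper triangular Gram matrix (the diagonal entries of the symmetric Gram matrix are even,
see `upperGram_add_transpose`). -/
def upperGram (Q : FinQuiver m n) : Matrix (Fin n) (Fin n) ℤ :=
  Matrix.of fun i j => if i < j then Q.gram i j else if i = j then Q.gram i i / 2 else 0

/-- The Coxeter-Laplacian `Id - I(Q) Ğ⁻¹ I(Q)ᵀ`. -/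
noncomputable def coxeterLaplacian (Q : FinQuiver m n) : Matrix (Fin m) (Fin m) ℤ :=
  1 - Q.incidence * Q.upperGram⁻¹ * Q.incidenceᵀ

/-- Source of the signed arrow `i^{+1}` or `i^{-1}`. -/
def sgnSrc (Q : FinQuiver m n) (a : Fin n × ℤˣ) : Fin m := if a.2 = 1 then Q.src a.1 else Q.tgt a.1

/-- Target of the signed arrow `i^{+1}` or `i^{-1}`. -/
def sgnTgt (Q : FinQuiver m n) (a : Fin n × ℤˣ) : Fin m := if a.2 = 1 then Q.tgt a.1 else Q.src a.1

/-- `Q.IsWalk u w v`: the list `w = i₁^{ε₁} ⋯ i_l^{ε_l}` of signed arrows is a walk from `u` to `v`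
(the empty list is the trivial walk at `u = v`). -/
def IsWalk (Q : FinQuiver m n) : Fin m → List (Fin n × ℤˣ) → Fin m → Prop
  | u, [], v => u = v
  | u, a :: w, v => Q.sgnSrc a = u ∧ Q.IsWalk (Q.sgnTgt a) w v

/-- Any two vertices are joined by a walk. -/
def Connected (Q : FinQuiver m n) : Prop := ∀ u v, ∃ w, Q.IsWalk u w v

/-- The incidence vector `∑ ε_t e_{i_t}` of a walk. -/
def inc (w : List (Fin n × ℤˣ)) : Fin n → ℤ :=
  (w.map fun a => Pi.single a.1 (a.2 : ℤ)).sum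

/-- A minimally descending walk: each arrow `i_{t+1}` is the largest one among the arrows `j < i_t`
incident with the target of `i_t^{ε_t}`, that is, `i_t - i_{t+1}` is the minimal positive difference
`i_t - j` over the arrows `j` such that `i_t^{ε_t} j^{± 1}` is a walk. -/
def IsMinDescending (Q : FinQuiver m n) (u : Fin m) (w : List (Fin n × ℤˣ)) (v : Fin m) : Prop :=
  Q.IsWalk u w v ∧
    w.IsChain fun a b =>
      IsGreatest {j | j < a.1 ∧ (Q.src j = Q.sgnTgt a ∨ Q.tgt j = Q.sgnTgt a)} b.1

/-- A (descending) structural walk: a minimally descending walk `w` such that whenever a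
concatenation `w' w w''` is minimally descending, both `w'` and `w''` are trivial. -/
def IsStructural (Q : FinQuiver m n) (u : Fin m) (w : List (Fin n × ℤˣ)) (v : Fin m) : Prop :=
  Q.IsMinDescending u w v ∧
    ∀ u' v' w' w'', Q.IsWalk u' w' u → Q.IsWalk v w'' v' →
      Q.IsMinDescending u' (w' ++ w ++ w'') v' → w' = [] ∧ w'' = []

/-- The inverse quiver `Q†`. The target of an arrow `i` in `Q†` is the target of the structural walk
of `Q` that contains `i^{+1}`, and its source in `Q†` is the target of the structural walk of `Q`
that contains `i^{-1}`. (If `Q` has no loops, each of these walks exists and is unique.) -/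
noncomputable def inverse (Q : FinQuiver m n) : FinQuiver m n where
  src i := @Classical.epsilon _ ⟨Q.src i⟩ fun x => ∃ u w, Q.IsStructural u w x ∧ (i, -1) ∈ w
  tgt i := @Classical.epsilon _ ⟨Q.src i⟩ fun x => ∃ u w, Q.IsStructural u w x ∧ (i, 1) ∈ w

theorem upperGram_add_transpose (Q : FinQuiver m n) : Q.upperGram + Q.upperGramᵀ = Q.gram := by
  have hsymm : ∀ i j, Q.gram i j = Q.gram j i := by
    intro i j
    simp only [gram, Matrix.mul_apply, Matrix.transpose_apply]
    exact Finset.sum_congr rfl fun _ _ => mul_comm _ _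
  have heven : ∀ i, 2 * (Q.gram i i / 2) = Q.gram i i := by
    intro i
    apply Int.mul_ediv_cancel'
    have h : Q.gram i i = ∑ v, Q.incidence v i * Q.incidence v i := by
      simp [gram, Matrix.mul_apply]
    have h0 : ∑ v, Q.incidence v i = 0 := by
      simp [incidence]
    have h1 : (2 : ℤ) ∣ ∑ v, (Q.incidence v i * Q.incidence v i - Q.incidence v i) := by
      apply Finset.dvd_sum
      intro v _
      have := Int.even_mul_pred_self (Q.incidence v i)
      rw [mul_sub, mul_one] at this
      exact this.two_dvd
    rw [Finset.sum_sub_distrib, h0, sub_zero, ← h] at h1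
    exact h1
  ext i j
  rcases lt_trichotomy i j with h | h | h
  · simp [upperGram, h, h.not_gt, h.ne']
  · subst h
    have := heven i
    simp [upperGram]
    linarith
  · simp [upperGram, h, h.not_gt, h.ne', hsymm i j]

/-- If `Q` has no loops, then its upper triangular Gram matrix is `ℤ`-invertible, so that the matrix
inverse in the definition of the Coxeter-Laplacian is a true inverse. -/
theorem det_upperGram (Q : FinQuiver m n) (h : Q.Loopless) : Q.upperGram.det = 1 := by
  have hd : ∀ i, Q.upperGram i i = 1 := by
    intro i
    have hi : Q.gram i i = 2 := by
      have h1 : ∀ v, Q.incidence v i * Q.incidence v i =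
          (if v = Q.src i then 1 else 0) + (if v = Q.tgt i then 1 else 0) := by
        intro v
        have := h i
        by_cases h2 : v = Q.src i <;> by_cases h3 : v = Q.tgt i <;> simp_all [incidence]
      simp only [gram, Matrix.mul_apply, Matrix.transpose_apply, h1, Finset.sum_add_distrib]
      simp
    simp [upperGram, hi]
  rw [Matrix.det_of_isUpperTriangular, Finset.prod_congr rfl fun i _ => hd i]
  · simp
  · intro i j hij
    have : j < i := hij
    simp [upperGram, this.not_gt, this.ne']

end FinQuiver

namespace StandardQuiver

open FinQuiver

variable {m : ℕ}

/-- The length `ℓ` of a partition. -/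
def len (π : m.Partition) : ℕ := Multiset.card π.parts

/-- `v_t = m - (π₁ + ⋯ + π_t)`, where `π₁ ≥ π₂ ≥ ⋯` are the parts of `π`. -/
def cut (π : m.Partition) (t : ℕ) : ℕ := m - ((π.parts.sort (· ≥ ·)).take t).sum

/-- The number of arrows `m + ℓ + 2 (d - 1)`. -/
def arrows (π : m.Partition) (d : ℕ) : ℕ := (m - 1) + (len π - 1) + 2 * d

/-- The vertex with label `x ∈ {1, …, m}`. -/
def vertex (hm : 2 ≤ m) (x : ℕ) : Fin m := ⟨(x - 1) % m, Nat.mod_lt _ (by omega)⟩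

/-- The labels (in `{1, …, m}`) of the source and of the target of the arrow with label `k` in
`{1, …, arrows π d}`. The first `m - 1` arrows are `k → k + 1`; the next `ℓ - 1` arrows
are `v_{t-1} → v_t`; the last `2 d` arrows are alternately antiparallel (`t` odd) and parallel
(`t` even) to the arrow `m - 1` if `ℓ = 1`, and to the arrow `v_{ℓ-2} → v_{ℓ-1}` if `ℓ > 1`. -/
def ends (π : m.Partition) (k : ℕ) : ℕ × ℕ :=
  if k ≤ m - 1 then (k, k + 1)
  else if k ≤ (m - 1) + (len π - 1) then
    let t := k - (m - 1)
    (cut π (t - 1), cut π t)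
  else
    let t := k - ((m - 1) + (len π - 1))
    let e := if len π = 1 then (m - 1, m) else (cut π (len π - 2), cut π (len π - 1))
    if Even t then e else e.swap

/-- The standard `(π, d)`-extension quiver. -/
def quiver (hm : 2 ≤ m) (π : m.Partition) (d : ℕ) : FinQuiver m (arrows π d) where
  src k := vertex hm (ends π (k + 1)).1
  tgt k := vertex hm (ends π (k + 1)).2

/-- `y_t = a_{v_{t-1}} - d_t`, where `d_t = b (v_t)`. -/
def yCol {n : ℕ} (hm : 2 ≤ m) (π : m.Partition) (a b : Fin m → Fin n → ℤ) (t : ℕ) : Fin n → ℤ :=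
  a (vertex hm (cut π (t - 1))) - b (vertex hm (cut π t))

/-- The column with label `k ∈ {1, …, arrows π d}` of the matrix assembled from the vectors `a v`
(for all vertices `v`) and `d_t = b (v_t)` (for `1 ≤ t ≤ ℓ - 1`). -/
def col {n : ℕ} (hm : 2 ≤ m) (π : m.Partition) (a b : Fin m → Fin n → ℤ) (k : ℕ) : Fin n → ℤ :=
  if k ≤ m - 1 then
    if k ∈ (Finset.Ico 1 (len π)).image (cut π) then b (vertex hm k) else a (vertex hm k)
  else if k ≤ (m - 1) + (len π - 1) then yCol hm π a b (k - (m - 1))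
  else
    let t := k - ((m - 1) + (len π - 1))
    let z := if len π = 1 then a (vertex hm (m - 1)) else yCol hm π a b (len π - 1)
    if Even t then z else -z

/-- `B` is a matrix built from the incidence vectors of the structural walks `α v` of `Q` starting
at the vertices `v`, and of some walks `δ (v_t)` of `Q` from `v_t` to `v_t + 1`, one for each
`1 ≤ t ≤ ℓ - 1`. -/
def IsStructuralMatrix (hm : 2 ≤ m) {d : ℕ} (π : m.Partition) (Q : FinQuiver m (arrows π d))
    (B : Matrix (Fin (arrows π d)) (Fin (arrows π d)) ℤ) : Prop :=
  ∃ α δ : Fin m → List (Fin (arrows π d) × ℤˣ),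
    (∀ v, ∃ x, Q.IsStructural v (α v) x) ∧
    (∀ t ∈ Finset.Ico 1 (len π),
      Q.IsWalk (vertex hm (cut π t)) (δ (vertex hm (cut π t))) (vertex hm (cut π t + 1))) ∧
    ∀ i k, B i k = col hm π (fun v => inc (α v)) (fun v => inc (δ v)) (k + 1) i

end StandardQuiver

/-! Write I for the incidence matrix, Ğ for `upperGram`, and s_i for the transposition of the ends
of arrow i. On basis vectors s_i is the reflection e_v ↦ e_v - I(v,i)(e_src - e_tgt). Telescoping
the product s₁⋯s_k (`descPerm_expand`) solves the triangular system X Ğ = I: column i of X is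
s₁⋯s_{i-1} applied to e_src - e_tgt (`invCol_mul_upperGram`). Hence Λ is the permutation matrix of ξ
= s₁⋯s_n (`coxeterLaplacian_apply`), and equality of the Laplacians means that Q and the standard
quiver share ξ.

Following s₁⋯s_n from v traces the structural walk at v (`IsStructural.eq_descWalk`,
`isStructural_descWalk`), which ends at ξ(v). So X is the incidence matrix of the inverse quiver.
Dually, the vectors a_v = inc(α⁻(v)) are the columns of Ğ⁻¹Iᵀ (`inv_mul_transpose`).

For the standard quiver, ξ sends v_{t-1} to v_t + 1 for 1 ≤ t < ℓ, sends v_{ℓ-1} to 1, and every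
other x to x + 1. The first equation compares boundaries of walks: a_v has boundary e_v - e_{ξ(v)}
and d_t has boundary e_{v_t} - e_{v_t+1}, so y_t has boundary e_{v_{t-1}} - e_{v_t} (`mulVec_col`).

For the second, the inverse arrows of i_{v_t} and j_t are both 1 → v_t + 1, so their coefficients
d_t and y_t add up to a_{v_{t-1}}; the last 2d inverse arrows are all equal, and their alternating
coefficients cancel. What remains is ∑_v a_v (e_1 - e_{ξ(v)})ᵀ (`sum_col_mul_invCol`). Since ∑_v a_v
= 0, only -∑_v a_v e_{ξ(v)}ᵀ survives, which is I(Q†)ᵀ by `invCol_descPerm`. -/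

namespace FinQuiver

/-! ### Descending permutations and the algebra of the triangular Gram matrix -/

variable {m n : ℕ}

/-- The permutation `s₁ ⋯ s_k`, where `s_i` exchanges the ends of the `i`-th arrow: it follows the
descending walks through the first `k` arrows. -/
def descPerm (Q : FinQuiver m n) : ℕ → Equiv.Perm (Fin m)
  | 0 => 1
  | k + 1 => if h : k < n then descPerm Q k * Equiv.swap (Q.src ⟨k, h⟩) (Q.tgt ⟨k, h⟩)
      else descPerm Q k

/-- The walk of length at most one that traverses the arrow `i` from `v`, if `i` is incident
with `v`. -/
def step (Q : FinQuiver m n) (i : Fin n) (v : Fin m) : List (Fin n × ℤˣ) :=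
  if v = Q.src i then [(i, 1)] else if v = Q.tgt i then [(i, -1)] else []

/-- The minimally descending walk from `v` that uses only the first `k` arrows. -/
def descWalk (Q : FinQuiver m n) : ℕ → Fin m → List (Fin n × ℤˣ)
  | 0, _ => []
  | k + 1, v => if h : k < n then
      Q.step ⟨k, h⟩ v ++ descWalk Q k (Equiv.swap (Q.src ⟨k, h⟩) (Q.tgt ⟨k, h⟩) v)
      else descWalk Q k v

/-- The arrow `j` is incident with the vertex `v`. -/
def Incident (Q : FinQuiver m n) (j : Fin n) (v : Fin m) : Prop := Q.src j = v ∨ Q.tgt j = v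

theorem descPerm_succ (Q : FinQuiver m n) (i : Fin n) (v : Fin m) :
    Q.descPerm (i + 1) v = Q.descPerm i (Equiv.swap (Q.src i) (Q.tgt i) v) := by
  simp [descPerm]

theorem descWalk_succ (Q : FinQuiver m n) (i : Fin n) (v : Fin m) :
    Q.descWalk (i + 1) v = Q.step i v ++ Q.descWalk i (Equiv.swap (Q.src i) (Q.tgt i) v) := by
  simp [descWalk]

theorem incidence_apply (Q : FinQuiver m n) (v : Fin m) (i : Fin n) :
    Q.incidence v i = (if v = Q.src i then 1 else 0) - (if v = Q.tgt i then 1 else 0) := rfl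

theorem gram_apply (Q : FinQuiver m n) (i j : Fin n) :
    Q.gram i j = Q.incidence (Q.src j) i - Q.incidence (Q.tgt j) i := by
  simp only [gram, Matrix.mul_apply, Matrix.transpose_apply]
  have h : ∀ v, Q.incidence v i * Q.incidence v j =
      (if v = Q.src j then Q.incidence v i else 0) - (if v = Q.tgt j then Q.incidence v i else 0) := by
    intro v
    rw [Q.incidence_apply v j, mul_sub]
    simp
  simp [h]

theorem upperGram_self (Q : FinQuiver m n) (h : Q.Loopless) (i : Fin n) : Q.upperGram i i = 1 := by
  have := h i
  simp [upperGram, gram_apply, incidence_apply, this, this.symm]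

theorem upperGram_of_lt (Q : FinQuiver m n) {i j : Fin n} (h : i < j) :
    Q.upperGram i j = Q.gram i j := by
  simp [upperGram, h]

theorem upperGram_of_gt (Q : FinQuiver m n) {i j : Fin n} (h : j < i) :
    Q.upperGram i j = 0 := by
  simp [upperGram, h.not_gt, h.ne']

/-- The incidence vector of the arrow `i` of the inverse quiver. -/
def invCol (Q : FinQuiver m n) (i : Fin n) (u : Fin m) : ℤ :=
  (if u = Q.descPerm i (Q.src i) then 1 else 0) - (if u = Q.descPerm i (Q.tgt i) then 1 else 0)

/-- Telescoping: replacing e_v by its reflection in arrow k and then applying the first k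
transpositions changes the result by exactly -I(v,k) times `invCol` of k. -/
theorem descPerm_expand (Q : FinQuiver m n) (h : Q.Loopless) (k : ℕ) (hk : k ≤ n) (u v : Fin m) :
    (if u = Q.descPerm k v then (1 : ℤ) else 0) =
      (if u = v then 1 else 0) -
        ∑ i : Fin n, if (i : ℕ) < k then Q.invCol i u * Q.incidence v i else 0 := by
  induction k generalizing v with
  | zero =>
    change (if u = v then (1 : ℤ) else 0) = _
    simp
  | succ k ih =>
    have key : ∀ i : Fin n, (if (i : ℕ) < k + 1 then Q.invCol i u * Q.incidence v i else 0) =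
        (if (i : ℕ) < k then Q.invCol i u * Q.incidence v i else 0) +
        (if i = ⟨k, hk⟩ then Q.invCol i u * Q.incidence v i else 0) := by
      intro i
      rcases lt_trichotomy (i : ℕ) k with h1 | h1 | h1
      · have : i ≠ ⟨k, hk⟩ := fun h => by simp [h] at h1
        simp [h1, this, Nat.lt_succ_of_lt h1]
      · have : i = ⟨k, hk⟩ := Fin.ext h1
        simp [this]
      · have : i ≠ ⟨k, hk⟩ := fun h => by simp [h] at h1
        simp [this, show ¬ (i : ℕ) < k + 1 by omega, show ¬ (i : ℕ) < k by omega]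
    rw [Finset.sum_congr rfl fun i _ => key i, Finset.sum_add_distrib]
    have hv := ih (by omega) v
    have hs := Q.descPerm_succ ⟨k, hk⟩ v
    have hl := h ⟨k, hk⟩
    simp only at hs
    rw [← sub_sub, ← hv, hs]
    simp only [Finset.sum_ite_eq', Finset.mem_univ, if_true, invCol, incidence_apply]
    by_cases h1 : v = Q.src ⟨k, hk⟩
    · subst h1
      simp [hl]
    · by_cases h2 : v = Q.tgt ⟨k, hk⟩
      · subst h2
        simp [hl.symm]
      · simp [h1, h2, Equiv.swap_apply_of_ne_of_ne h1 h2]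

/-- Entries of Ğ above the diagonal in column j are differences of incidence entries at the ends of
j, so the sum is the difference of `descPerm_expand` at those two ends with k = j; the unit diagonal
contributes `invCol` of j itself, which cancels the permuted terms. -/
theorem invCol_mul_upperGram (Q : FinQuiver m n) (h : Q.Loopless) :
    (Matrix.of fun u i => Q.invCol i u) * Q.upperGram = Q.incidence := by
  ext u j
  rw [Matrix.mul_apply]
  have key : ∀ i : Fin n, (Matrix.of fun u i => Q.invCol i u) u i * Q.upperGram i j =
      (if (i : ℕ) < j then Q.invCol i u * Q.incidence (Q.src j) i else 0) -
      (if (i : ℕ) < j then Q.invCol i u * Q.incidence (Q.tgt j) i else 0) +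
      (if i = j then Q.invCol i u else 0) := by
    intro i
    rcases lt_trichotomy i j with h1 | h1 | h1
    · have h2 : (i : ℕ) < j := h1
      simp only [Matrix.of_apply, Q.upperGram_of_lt h1, gram_apply, h2, if_true, h1.ne, if_false]
      ring
    · subst h1
      simp [Q.upperGram_self h]
    · have h2 : ¬ (i : ℕ) < j := not_lt.2 (le_of_lt h1)
      simp [Q.upperGram_of_gt h1, h2, h1.ne']
  rw [Finset.sum_congr rfl fun i _ => key i, Finset.sum_add_distrib, Finset.sum_sub_distrib]
  have h1 := Q.descPerm_expand h j j.2.le u (Q.src j)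
  have h2 := Q.descPerm_expand h j j.2.le u (Q.tgt j)
  simp only [Finset.sum_ite_eq', Finset.mem_univ, if_true]
  simp only [invCol, incidence_apply] at h1 h2 ⊢
  linarith

theorem isUnit_det_upperGram (Q : FinQuiver m n) (h : Q.Loopless) : IsUnit Q.upperGram.det := by
  rw [Q.det_upperGram h]; exact isUnit_one

theorem incidence_mul_inv (Q : FinQuiver m n) (h : Q.Loopless) :
    Q.incidence * Q.upperGram⁻¹ = Matrix.of fun u i => Q.invCol i u := by
  rw [← Q.invCol_mul_upperGram h, Matrix.mul_nonsing_inv_cancel_right _ _ (Q.isUnit_det_upperGram h)]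

theorem coxeterLaplacian_apply (Q : FinQuiver m n) (h : Q.Loopless) (u v : Fin m) :
    Q.coxeterLaplacian u v = if u = Q.descPerm n v then 1 else 0 := by
  rw [coxeterLaplacian, Q.incidence_mul_inv h, Q.descPerm_expand h n le_rfl]
  simp [Matrix.mul_apply, Matrix.one_apply]

theorem inc_append (w w' : List (Fin n × ℤˣ)) : inc (w ++ w') = inc w + inc w' := by
  simp [inc]

theorem inc_cons (a : Fin n × ℤˣ) (w : List (Fin n × ℤˣ)) :
    inc (a :: w) = Pi.single a.1 (a.2 : ℤ) + inc w := by
  simp [inc]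

theorem inc_step (Q : FinQuiver m n) (h : Q.Loopless) (i : Fin n) (v : Fin m) :
    inc (Q.step i v) = Pi.single i (Q.incidence v i) := by
  have := h i
  rw [step, incidence_apply]
  split_ifs with h1 h2 h2
  · exact absurd (h1.symm.trans h2) this
  · simp [inc]
  · simp [inc]
  · simp [inc]

theorem inc_descWalk_eq_zero (Q : FinQuiver m n) (h : Q.Loopless) (k : ℕ) (v : Fin m) (j : Fin n)
    (hj : k ≤ j) : inc (Q.descWalk k v) j = 0 := by
  induction k generalizing v with
  | zero => simp [descWalk, inc]
  | succ k ih =>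
    have hk : k < n := by omega
    have hjk : j ≠ ⟨k, hk⟩ := fun h => by simp [h] at hj
    have := Q.descWalk_succ ⟨k, hk⟩ v
    simp only at this
    rw [this, inc_append, Pi.add_apply, ih _ (by omega), inc_step Q h]
    simp [hjk]

/-- The reflection formula for a transposition, read on rows of the incidence matrix. -/
theorem incidence_swap (Q : FinQuiver m n) (h : Q.Loopless) (i k : Fin n) (v : Fin m) :
    Q.incidence (Equiv.swap (Q.src k) (Q.tgt k) v) i =
      Q.incidence v i - Q.gram i k * Q.incidence v k := by
  have hl := h k
  rw [gram_apply, Q.incidence_apply v k]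
  by_cases h1 : v = Q.src k
  · subst h1; simp [hl]
  · by_cases h2 : v = Q.tgt k
    · subst h2; simp [hl.symm]
    · simp [h1, h2, Equiv.swap_apply_of_ne_of_ne h1 h2]

/-- Back substitution: the step at arrow k fixes coordinate k, and by `incidence_swap` moving v
across that arrow makes exactly the correction needed in the smaller rows. -/
theorem upperGram_mulVec_inc_descWalk (Q : FinQuiver m n) (h : Q.Loopless) (k : ℕ) (hk : k ≤ n)
    (v : Fin m) (i : Fin n) (hi : (i : ℕ) < k) :
    (Q.upperGram *ᵥ inc (Q.descWalk k v)) i = Q.incidence v i := by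
  induction k generalizing v with
  | zero => omega
  | succ k ih =>
    have hs := Q.descWalk_succ ⟨k, hk⟩ v
    simp only at hs
    rw [hs, inc_append, Matrix.mulVec_add, Pi.add_apply, inc_step Q h, Matrix.mulVec_single]
    rcases Nat.lt_succ_iff_lt_or_eq.1 hi with h1 | h1
    · rw [ih (by omega) _ h1, Q.incidence_swap h]
      have : i < ⟨k, hk⟩ := h1
      simp [Q.upperGram_of_lt this]
    · have hik : i = ⟨k, hk⟩ := Fin.ext h1
      have h0 : (Q.upperGram *ᵥ inc (Q.descWalk k
          (Equiv.swap (Q.src ⟨k, hk⟩) (Q.tgt ⟨k, hk⟩) v))) i = 0 := by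
        rw [Matrix.mulVec, dotProduct]
        refine Finset.sum_eq_zero fun j _ => ?_
        by_cases hj : (j : ℕ) < k
        · rw [Q.upperGram_of_gt (show j < i by rw [hik]; exact hj), zero_mul]
        · rw [Q.inc_descWalk_eq_zero h _ _ _ (by omega), mul_zero]
      rw [h0, hik]
      simp [Q.upperGram_self h]

/-- The incidence vectors of the full descending walks are the columns of `Ğ⁻¹ I(Q)ᵀ`. -/
theorem inv_mul_transpose (Q : FinQuiver m n) (h : Q.Loopless) :
    Q.upperGram⁻¹ * Q.incidenceᵀ = Matrix.of fun i v => inc (Q.descWalk n v) i := by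
  have : Q.upperGram * (Matrix.of fun i v => inc (Q.descWalk n v) i) = Q.incidenceᵀ := by
    ext i v
    exact Q.upperGram_mulVec_inc_descWalk h n le_rfl v i i.2
  rw [← this, Matrix.nonsing_inv_mul_cancel_left _ _ (Q.isUnit_det_upperGram h)]

/-- The rows of Iᵀ sum to zero, hence so do those of Ğ⁻¹Iᵀ. -/
theorem sum_inc_descWalk (Q : FinQuiver m n) (h : Q.Loopless) (i : Fin n) :
    ∑ v, inc (Q.descWalk n v) i = 0 := by
  have h1 : Q.incidenceᵀ *ᵥ (fun _ => 1) = 0 := by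
    ext j
    simp [Matrix.mulVec, dotProduct, incidence_apply]
  have h2 : (Q.upperGram⁻¹ * Q.incidenceᵀ) *ᵥ (fun _ => 1) = 0 := by
    rw [← Matrix.mulVec_mulVec, h1, Matrix.mulVec_zero]
  rw [Q.inv_mul_transpose h] at h2
  simpa [Matrix.mulVec, dotProduct] using congrFun h2 i

/-- Substituting IᵀI = Ğ + Ğᵀ gives IᵀΛ = -ĞᵀĞ⁻¹Iᵀ, hence (IĞ⁻¹)ᵀΛ = -Ğ⁻¹Iᵀ; since Λ is a
permutation matrix, this can be read entrywise. -/
theorem invCol_descPerm (Q : FinQuiver m n) (h : Q.Loopless) (i : Fin n) (v : Fin m) :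
    Q.invCol i (Q.descPerm n v) = - inc (Q.descWalk n v) i := by
  have hu := Q.isUnit_det_upperGram h
  have hut : IsUnit Q.upperGramᵀ.det := by rwa [Matrix.det_transpose]
  have key : (Q.incidence * Q.upperGram⁻¹)ᵀ * Q.coxeterLaplacian =
      - (Q.upperGram⁻¹ * Q.incidenceᵀ) := by
    have h1 : Q.incidenceᵀ * Q.coxeterLaplacian =
        - (Q.upperGramᵀ * (Q.upperGram⁻¹ * Q.incidenceᵀ)) := by
      have h2 : Q.incidenceᵀ * (Q.incidence * Q.upperGram⁻¹ * Q.incidenceᵀ) =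
          Q.gram * (Q.upperGram⁻¹ * Q.incidenceᵀ) := by
        simp only [gram, Matrix.mul_assoc]
      rw [coxeterLaplacian, Matrix.mul_sub, Matrix.mul_one, h2, ← upperGram_add_transpose,
        Matrix.add_mul, Matrix.mul_nonsing_inv_cancel_left _ _ hu]
      abel
    rw [Matrix.transpose_mul, Matrix.transpose_nonsing_inv, Matrix.mul_assoc, h1, Matrix.mul_neg,
      Matrix.nonsing_inv_mul_cancel_left _ _ hut]
  rw [Q.inv_mul_transpose h, Q.incidence_mul_inv h] at key
  have := congrFun (congrFun key i) v
  simpa [Matrix.mul_apply, Q.coxeterLaplacian_apply h] using this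

end FinQuiver

/-! ### Structural walks and the inverse quiver -/

namespace FinQuiver

variable {m n : ℕ}

theorem isWalk_append (Q : FinQuiver m n) {u x : Fin m} {w w' : List (Fin n × ℤˣ)} :
    Q.IsWalk u (w ++ w') x ↔ ∃ v, Q.IsWalk u w v ∧ Q.IsWalk v w' x := by
  induction w generalizing u with
  | nil => simp [IsWalk]
  | cons a w ih => simp [IsWalk, ih, and_assoc]

theorem IsWalk.unique {Q : FinQuiver m n} {u x y : Fin m} {w : List (Fin n × ℤˣ)}
    (h : Q.IsWalk u w x) (h' : Q.IsWalk u w y) : x = y := by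
  induction w generalizing u with
  | nil => exact (Eq.symm h).trans h'
  | cons a w ih => exact ih h.2 h'.2

theorem incidence_mulVec_inc (Q : FinQuiver m n) {u v : Fin m} {w : List (Fin n × ℤˣ)}
    (h : Q.IsWalk u w v) (x : Fin m) :
    (Q.incidence *ᵥ inc w) x = (if x = u then 1 else 0) - (if x = v then 1 else 0) := by
  induction w generalizing u with
  | nil =>
    have : u = v := h
    simp [inc, this]
  | cons a w ih =>
    obtain ⟨h1, h2⟩ := h
    rw [inc_cons, Matrix.mulVec_add, Pi.add_apply, ih h2, Matrix.mulVec_single, ← h1]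
    rcases Int.units_eq_one_or a.2 with h3 | h3 <;>
      simp [h3, sgnSrc, sgnTgt, incidence_apply]

theorem incident_sgnSrc (Q : FinQuiver m n) (a : Fin n × ℤˣ) : Q.Incident a.1 (Q.sgnSrc a) := by
  unfold sgnSrc Incident; split_ifs <;> simp

theorem incident_sgnTgt (Q : FinQuiver m n) (a : Fin n × ℤˣ) : Q.Incident a.1 (Q.sgnTgt a) := by
  unfold sgnTgt Incident; split_ifs <;> simp

theorem Incident.exists_sgnSrc {Q : FinQuiver m n} {j : Fin n} {v : Fin m} (h : Q.Incident j v) :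
    ∃ ε : ℤˣ, Q.sgnSrc (j, ε) = v := by
  rcases h with h | h
  · exact ⟨1, by simpa [sgnSrc] using h⟩
  · exact ⟨-1, by simpa [sgnSrc] using h⟩

theorem Incident.exists_sgnTgt {Q : FinQuiver m n} {j : Fin n} {v : Fin m} (h : Q.Incident j v) :
    ∃ ε : ℤˣ, Q.sgnTgt (j, ε) = v := by
  rcases h with h | h
  · exact ⟨-1, by simpa [sgnTgt] using h⟩
  · exact ⟨1, by simpa [sgnTgt] using h⟩

/-- Among the first `k` arrows, `j` is the largest one incident with `v`. -/
def IsTop (Q : FinQuiver m n) (k : ℕ) (v : Fin m) (j : Fin n) : Prop :=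
  IsGreatest {j : Fin n | (j : ℕ) < k ∧ Q.Incident j v} j

theorem isTop_or_isolated (Q : FinQuiver m n) (k : ℕ) (v : Fin m) :
    (∀ j : Fin n, (j : ℕ) < k → ¬ Q.Incident j v) ∨
      ∃ a : Fin n × ℤˣ, Q.IsTop k v a.1 ∧ Q.sgnSrc a = v := by
  by_cases h : ∃ j : Fin n, (j : ℕ) < k ∧ Q.Incident j v
  · right
    have hf : {j : Fin n | (j : ℕ) < k ∧ Q.Incident j v}.Finite := Set.toFinite _
    obtain ⟨j, hj⟩ := hf.exists_maximal h
    have hg : Q.IsTop k v j := ⟨hj.1, fun i hi => by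
      rcases le_total i j with h1 | h1
      · exact h1
      · exact hj.2 hi h1⟩
    obtain ⟨ε, hε⟩ := hg.1.2.exists_sgnSrc
    exact ⟨(j, ε), hg, hε⟩
  · left
    exact fun j hj hi => h ⟨j, hj, hi⟩

theorem step_eq_singleton {Q : FinQuiver m n} (h : Q.Loopless) (a : Fin n × ℤˣ) :
    Q.step a.1 (Q.sgnSrc a) = [a] ∧
      Equiv.swap (Q.src a.1) (Q.tgt a.1) (Q.sgnSrc a) = Q.sgnTgt a := by
  obtain ⟨i, ε⟩ := a
  have := h i
  rcases Int.units_eq_one_or ε with rfl | rfl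
  · simp [step, sgnSrc, sgnTgt]
  · simp [step, sgnSrc, sgnTgt, this.symm]

theorem step_eq_nil {Q : FinQuiver m n} {i : Fin n} {v : Fin m} (h : ¬ Q.Incident i v) :
    Q.step i v = [] ∧ Equiv.swap (Q.src i) (Q.tgt i) v = v := by
  unfold Incident at h
  push Not at h
  exact ⟨by simp [step, h.1.symm, h.2.symm],
    Equiv.swap_apply_of_ne_of_ne h.1.symm h.2.symm⟩

theorem descWalk_eq_nil (Q : FinQuiver m n) {k : ℕ} {v : Fin m}
    (h : ∀ j : Fin n, (j : ℕ) < k → ¬ Q.Incident j v) : Q.descWalk k v = [] := by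
  induction k with
  | zero => rfl
  | succ k ih =>
    have ih := ih fun j hj => h j (by omega)
    rw [descWalk]
    split_ifs with hk
    · have := step_eq_nil (h ⟨k, hk⟩ (by simp))
      rw [this.1, this.2, ih, List.nil_append]
    · exact ih

theorem descWalk_eq_cons (Q : FinQuiver m n) (hl : Q.Loopless) {k : ℕ} {v : Fin m}
    {a : Fin n × ℤˣ} (h : Q.IsTop k v a.1) (ha : Q.sgnSrc a = v) :
    Q.descWalk k v = a :: Q.descWalk a.1 (Q.sgnTgt a) := by
  induction k with
  | zero => exact absurd h.1.1 (by omega)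
  | succ k ih =>
    rcases Nat.lt_succ_iff_lt_or_eq.1 h.1.1 with h1 | h1
    · have ih := ih ⟨⟨h1, h.1.2⟩, fun j hj => h.2 ⟨Nat.lt_succ_of_lt hj.1, hj.2⟩⟩
      rw [descWalk]
      split_ifs with hk
      · have := step_eq_nil (Q := Q) (i := ⟨k, hk⟩) (v := v) fun hi => by
          have : (⟨k, hk⟩ : Fin n) ≤ a.1 := h.2 ⟨by simp, hi⟩
          have : k ≤ a.1 := this
          omega
        rw [this.1, this.2, ih, List.nil_append]
      · exact ih
    · subst h1
      have := step_eq_singleton hl a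
      rw [descWalk_succ, ← ha, this.1, this.2]
      rfl

theorem isTop_of_mem_head? (Q : FinQuiver m n) (hl : Q.Loopless) {k : ℕ} {v : Fin m}
    {a : Fin n × ℤˣ} (h : a ∈ (Q.descWalk k v).head?) : Q.IsTop k v a.1 := by
  rcases Q.isTop_or_isolated k v with h1 | ⟨b, h1, h2⟩
  · simp [Q.descWalk_eq_nil h1] at h
  · rw [Q.descWalk_eq_cons hl h1 h2] at h
    simp at h
    exact h ▸ h1

theorem isWalk_descWalk (Q : FinQuiver m n) (k : ℕ) (v : Fin m) :
    Q.IsWalk v (Q.descWalk k v) (Q.descPerm k v) := by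
  induction k generalizing v with
  | zero => rfl
  | succ k ih =>
    rw [descWalk, descPerm]
    split_ifs with hk
    · rw [isWalk_append]
      refine ⟨_, ?_, ih _⟩
      unfold step
      split_ifs with h1 h2
      · simp [IsWalk, sgnSrc, sgnTgt, h1]
      · simp [IsWalk, sgnSrc, sgnTgt, h2]
      · exact (Equiv.swap_apply_of_ne_of_ne h1 h2).symm
    · exact ih v

theorem isChain_descWalk (Q : FinQuiver m n) (hl : Q.Loopless) (k : ℕ) (v : Fin m) :
    (Q.descWalk k v).IsChain fun a b =>
      IsGreatest {j | j < a.1 ∧ (Q.src j = Q.sgnTgt a ∨ Q.tgt j = Q.sgnTgt a)} b.1 := by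
  induction k using Nat.strong_induction_on generalizing v with
  | _ k ih =>
    rcases Q.isTop_or_isolated k v with h1 | ⟨b, h1, h2⟩
    · rw [Q.descWalk_eq_nil h1]; exact List.IsChain.nil
    · rw [Q.descWalk_eq_cons hl h1 h2, List.isChain_cons]
      exact ⟨fun c hc => Q.isTop_of_mem_head? hl hc, ih _ h1.1.1 _⟩

theorem isMinDescending_descWalk (Q : FinQuiver m n) (hl : Q.Loopless) (k : ℕ) (v : Fin m) :
    Q.IsMinDescending v (Q.descWalk k v) (Q.descPerm k v) :=
  ⟨Q.isWalk_descWalk k v, Q.isChain_descWalk hl k v⟩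

/-- A minimally descending walk whose first arrow is the largest possible one is an initial segment
of the corresponding descending walk. -/
theorem IsMinDescending.exists_append {Q : FinQuiver m n} (hl : Q.Loopless) {k : ℕ} {u x : Fin m}
    {w : List (Fin n × ℤˣ)} (hw : Q.IsMinDescending u w x)
    (hh : ∀ a ∈ w.head?, Q.IsTop k u a.1) : ∃ w', w ++ w' = Q.descWalk k u := by
  induction w generalizing k u with
  | nil => exact ⟨_, rfl⟩
  | cons a w ih =>
    obtain ⟨⟨h1, h2⟩, h3⟩ := hw
    rw [List.isChain_cons] at h3
    obtain ⟨w', hw'⟩ := ih ⟨h2, h3.2⟩ (k := a.1) h3.1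
    exact ⟨w', by rw [Q.descWalk_eq_cons hl (hh a rfl) h1, List.cons_append, hw']⟩

/-- Left maximality forces the first arrow to be the largest one at u, so the walk is a prefix of
`descWalk`; right maximality makes it the whole. -/
theorem IsStructural.eq_descWalk {Q : FinQuiver m n} (hl : Q.Loopless) {u x : Fin m}
    {w : List (Fin n × ℤˣ)} (hw : Q.IsStructural u w x) :
    w = Q.descWalk n u ∧ x = Q.descPerm n u := by
  obtain ⟨hd, hmax⟩ := hw
  have hh : ∀ a ∈ w.head?, Q.IsTop n u a.1 := by
    intro a ha
    obtain ⟨w₀, rfl⟩ := List.head?_eq_some_iff.1 ha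
    have hau : Q.Incident a.1 u := by
      rw [← hd.1.1]; exact Q.incident_sgnSrc a
    refine ⟨⟨a.1.2, hau⟩, fun j hj => ?_⟩
    by_contra hja
    have hf : {j : Fin n | a.1 < j ∧ Q.Incident j u}.Finite := Set.toFinite _
    -- The smallest arrow at u above a, oriented towards u, can be prepended: a is then the largest
    -- arrow at u below it.
    obtain ⟨b, hb⟩ := hf.exists_minimal ⟨j, lt_of_not_ge hja, hj.2⟩
    obtain ⟨ε, hε⟩ := hb.1.2.exists_sgnTgt
    have := hmax (Q.sgnSrc (b, ε)) x [(b, ε)] [] ⟨rfl, hε⟩ rfl (by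
      rw [List.append_nil]
      refine ⟨⟨rfl, hε.symm ▸ hd.1⟩, List.isChain_cons.2 ⟨fun c hc => ?_, hd.2⟩⟩
      obtain rfl : a = c := Option.some.inj hc
      rw [hε]
      refine ⟨⟨hb.1.1, hau⟩, fun i hi => ?_⟩
      by_contra hi'
      exact absurd (hb.2 ⟨lt_of_not_ge hi', hi.2⟩ (le_of_lt hi.1)) (not_le.2 hi.1))
    simp at this
  obtain ⟨w', hw'⟩ := hd.exists_append hl hh
  have hW := Q.isMinDescending_descWalk hl n u
  rw [← hw'] at hW
  obtain ⟨y, hy1, hy2⟩ := (Q.isWalk_append).1 hW.1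
  obtain rfl := hy1.unique hd.1
  have := (hmax u _ [] w' rfl hy2 (by simpa using hW)).2
  subst this
  rw [List.append_nil] at hw'
  exact ⟨hw', hd.1.unique (hw' ▸ Q.isWalk_descWalk n u)⟩

theorem isStructural_descWalk (Q : FinQuiver m n) (hl : Q.Loopless) (u : Fin m) :
    Q.IsStructural u (Q.descWalk n u) (Q.descPerm n u) := by
  refine ⟨Q.isMinDescending_descWalk hl n u, fun u' v' w' w'' hw' hw'' hd => ?_⟩
  have hnil : w' = [] := by
    rcases List.eq_nil_or_concat w' with h | ⟨w₀, b, rfl⟩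
    · exact h
    · exfalso
      rw [List.concat_eq_append] at hw' hd
      obtain ⟨y, -, -, hy⟩ := Q.isWalk_append.1 hw'
      have hbu : Q.Incident b.1 u := by
        rw [← show Q.sgnTgt b = u from hy]; exact Q.incident_sgnTgt b
      rcases Q.isTop_or_isolated n u with h1 | ⟨a, h1, h2⟩
      · exact h1 _ b.1.2 hbu
      · rw [Q.descWalk_eq_cons hl h1 h2, List.append_assoc] at hd
        -- Prepending b would force a < b, but a is the largest arrow at u.
        have := (List.isChain_append.1 hd.2).2.2 b (by simp) a (by simp)
        exact absurd (h1.2 ⟨b.1.2, hbu⟩) (not_le.2 this.1.1)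
  subst hnil
  refine ⟨rfl, ?_⟩
  obtain rfl : u' = u := hw'
  rw [List.nil_append] at hd
  obtain ⟨w₃, hw₃⟩ := hd.exists_append hl (k := n) (by
    intro a ha
    rcases Q.isTop_or_isolated n u' with h1 | ⟨b, h1, h2⟩
    · rw [Q.descWalk_eq_nil h1, List.nil_append] at ha hd
      obtain ⟨w₀, rfl⟩ := List.head?_eq_some_iff.1 ha
      exact absurd (hd.1.1 ▸ Q.incident_sgnSrc a) (h1 _ a.1.2)
    · apply Q.isTop_of_mem_head? hl
      rw [Q.descWalk_eq_cons hl h1 h2] at ha ⊢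
      simpa using ha)
  rw [List.append_assoc] at hw₃
  -- The extended walk is itself a prefix of the descending walk, leaving no room for w''.
  have := List.append_right_eq_self.1 hw₃
  exact (List.append_eq_nil_iff.1 this).1

theorem mem_step {Q : FinQuiver m n} {i : Fin n} {v : Fin m} {a : Fin n × ℤˣ}
    (h : a ∈ Q.step i v) : a.1 = i ∧ Q.sgnSrc a = v := by
  unfold step at h
  split_ifs at h with h1 h2
  · simp at h; subst h; simp [sgnSrc, h1]
  · simp at h; subst h; simp [sgnSrc, h2]
  · simp at h

/-- Once a descending walk has crossed a, its continuation depends only on a, not on the starting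
vertex. -/
theorem descPerm_of_mem_descWalk (Q : FinQuiver m n) (hl : Q.Loopless) {k : ℕ} {u : Fin m}
    {a : Fin n × ℤˣ} (h : a ∈ Q.descWalk k u) : Q.descPerm k u = Q.descPerm a.1 (Q.sgnTgt a) := by
  induction k generalizing u with
  | zero => simp [descWalk] at h
  | succ k ih =>
    rw [descWalk] at h
    rw [descPerm]
    split_ifs at h ⊢ with hk
    · rw [Equiv.Perm.mul_apply]
      rcases List.mem_append.1 h with h | h
      · obtain ⟨h1, h2⟩ := mem_step h
        rw [← h2, ← h1, (step_eq_singleton hl a).2, h1]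
      · exact ih h
    · exact ih h

theorem exists_mem_descWalk (Q : FinQuiver m n) (hl : Q.Loopless) (a : Fin n × ℤˣ) {k : ℕ}
    (hk : a.1 < k) : ∃ u, a ∈ Q.descWalk k u := by
  induction k with
  | zero => omega
  | succ k ih =>
    rcases Nat.lt_succ_iff_lt_or_eq.1 hk with h1 | h1
    · obtain ⟨u, hu⟩ := ih h1
      by_cases hkn : k < n
      -- The starting vertex is pulled back through the transposition, so that after arrow k the
      -- walk continues from u.
      · refine ⟨Equiv.swap (Q.src ⟨k, hkn⟩) (Q.tgt ⟨k, hkn⟩) u, ?_⟩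
        rw [descWalk, dif_pos hkn, Equiv.swap_apply_self]
        exact List.mem_append_right _ hu
      · exact ⟨u, by rwa [descWalk, dif_neg hkn]⟩
    · subst h1
      refine ⟨Q.sgnSrc a, ?_⟩
      rw [descWalk_succ, (step_eq_singleton hl a).1]
      simp

/-- All structural walks through a have the same target, so the choice operator has only one
possible value. -/
theorem epsilon_structural (Q : FinQuiver m n) (hl : Q.Loopless) (a : Fin n × ℤˣ)
    (hne : Nonempty (Fin m)) :
    @Classical.epsilon _ hne (fun x => ∃ u w, Q.IsStructural u w x ∧ a ∈ w) =
      Q.descPerm a.1 (Q.sgnTgt a) := by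
  have hex : ∃ x, ∃ u w, Q.IsStructural u w x ∧ a ∈ w := by
    obtain ⟨u, hu⟩ := Q.exists_mem_descWalk hl a a.1.2
    exact ⟨_, u, _, Q.isStructural_descWalk hl u, hu⟩
  obtain ⟨u, w, hw, ha⟩ := @Classical.epsilon_spec _ _ hex
  obtain ⟨h1, h2⟩ := hw.eq_descWalk hl
  rw [h1] at ha
  rw [← Q.descPerm_of_mem_descWalk hl ha, ← h2]

theorem inverse_incidence_apply (Q : FinQuiver m n) (hl : Q.Loopless) (u : Fin m) (i : Fin n) :
    Q.inverse.incidence u i = Q.invCol i u := by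
  have h1 : Q.inverse.src i = Q.descPerm i (Q.src i) := by
    exact (Q.epsilon_structural hl (i, -1) ⟨Q.src i⟩).trans (by simp [sgnTgt])
  have h2 : Q.inverse.tgt i = Q.descPerm i (Q.tgt i) := by
    exact (Q.epsilon_structural hl (i, 1) ⟨Q.src i⟩).trans (by simp [sgnTgt])
  rw [incidence_apply, h1, h2, invCol]

/-- The incidence matrix of the inverse quiver. -/
theorem inverse_incidence (Q : FinQuiver m n) (hl : Q.Loopless) :
    Q.inverse.incidence = Q.incidence * Q.upperGram⁻¹ := by
  rw [Q.incidence_mul_inv hl]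
  ext u i
  exact Q.inverse_incidence_apply hl u i

end FinQuiver

/-! ### Cuts of the partition and arrows of the standard quiver -/

namespace StandardQuiver

open FinQuiver

variable {m : ℕ}

theorem cut_eq_sum_drop (π : m.Partition) (t : ℕ) :
    cut π t = ((π.parts.sort (· ≥ ·)).drop t).sum := by
  have h : (π.parts.sort (· ≥ ·)).sum = m := by
    rw [← Multiset.sum_coe, Multiset.sort_eq, π.parts_sum]
  have := List.sum_take_add_sum_drop (π.parts.sort (· ≥ ·)) t
  rw [cut]
  omega

theorem cut_zero (π : m.Partition) : cut π 0 = m := by simp [cut]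

theorem cut_len (π : m.Partition) : cut π (len π) = 0 := by
  rw [cut_eq_sum_drop, List.drop_eq_nil_of_le (by simp [len])]
  rfl

theorem cut_succ_lt (π : m.Partition) {t : ℕ} (ht : t < len π) : cut π (t + 1) < cut π t := by
  have hl : t < (π.parts.sort (· ≥ ·)).length := by simpa [len] using ht
  rw [cut_eq_sum_drop, cut_eq_sum_drop, List.drop_eq_getElem_cons hl, List.sum_cons]
  have : 0 < (π.parts.sort (· ≥ ·))[t] :=
    π.parts_pos ((Multiset.mem_sort (r := (· ≥ ·))).1 (List.getElem_mem hl))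
  omega

theorem cut_lt (π : m.Partition) {s t : ℕ} (hst : s < t) (ht : t ≤ len π) :
    cut π t < cut π s := by
  induction t with
  | zero => omega
  | succ t ih =>
    have h1 := cut_succ_lt π (t := t) (by omega)
    rcases Nat.lt_succ_iff_lt_or_eq.1 hst with h | h
    · exact h1.trans (ih h (by omega))
    · rwa [h]

theorem cut_inj (π : m.Partition) {s t : ℕ} (hs : s < len π) (ht : t < len π)
    (h : cut π s = cut π t) : s = t := by
  rcases lt_trichotomy s t with h1 | h1 | h1
  · have := cut_lt π h1 ht.le; omega
  · exact h1
  · have := cut_lt π h1 hs.le; omega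

theorem cut_pos (π : m.Partition) {t : ℕ} (ht : t < len π) : 1 ≤ cut π t := by
  have := cut_succ_lt π ht
  omega

theorem cut_le (π : m.Partition) (t : ℕ) : cut π t ≤ m := Nat.sub_le _ _

theorem cut_lt_self (π : m.Partition) {t : ℕ} (h0 : 0 < t) (ht : t < len π) : cut π t < m := by
  have := cut_lt π h0 ht.le
  rwa [cut_zero] at this

theorem len_pos (hm : 2 ≤ m) (π : m.Partition) : 1 ≤ len π := by
  by_contra h
  have h1 := cut_len π
  rw [show len π = 0 by omega, cut_zero] at h1
  omega

theorem vertex_inj (hm : 2 ≤ m) {x y : ℕ} (hx : 1 ≤ x) (hx' : x ≤ m) (hy : 1 ≤ y) (hy' : y ≤ m)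
    (h : vertex hm x = vertex hm y) : x = y := by
  simp only [vertex, Fin.mk.injEq] at h
  rw [Nat.mod_eq_of_lt (by omega), Nat.mod_eq_of_lt (by omega)] at h
  omega

theorem vertex_ne (hm : 2 ≤ m) {x y : ℕ} (hx : 1 ≤ x) (hx' : x ≤ m) (hy : 1 ≤ y) (hy' : y ≤ m)
    (h : x ≠ y) : vertex hm x ≠ vertex hm y := fun e => h (vertex_inj hm hx hx' hy hy' e)

theorem vertex_succ (hm : 2 ≤ m) (v : Fin m) : vertex hm (v + 1) = v := by
  ext
  simp [vertex, Nat.mod_eq_of_lt v.2]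

theorem ends_of_le (π : m.Partition) {k : ℕ} (hk : k ≤ m - 1) : ends π k = (k, k + 1) := by
  simp [ends, hk]

theorem ends_middle (π : m.Partition) {t : ℕ} (ht : t < len π - 1) :
    ends π (m - 1 + t + 1) = (cut π t, cut π (t + 1)) := by
  rw [ends, if_neg (by omega), if_pos (by omega)]
  simp only
  rw [show m - 1 + t + 1 - (m - 1) = t + 1 by omega, Nat.add_sub_cancel]

/-- The labels of the ends of the arrow to which the last `2 d` arrows are (anti)parallel. -/
def lastEnds (π : m.Partition) : ℕ × ℕ :=
  if len π = 1 then (m - 1, m) else (cut π (len π - 2), cut π (len π - 1))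

theorem ends_last (π : m.Partition) (t : ℕ) :
    ends π (m - 1 + (len π - 1) + t + 1) =
      if Even t then (lastEnds π).swap else lastEnds π := by
  rw [ends, if_neg (by omega), if_neg (by omega)]
  simp only [lastEnds]
  rw [show m - 1 + (len π - 1) + t + 1 - (m - 1 + (len π - 1)) = t + 1 by omega]
  by_cases h : Even t <;> simp [h, Nat.even_add_one]

theorem lastEnds_spec (hm : 2 ≤ m) (π : m.Partition) :
    vertex hm (lastEnds π).1 ≠ vertex hm (lastEnds π).2 := by
  have h0 := len_pos hm π
  unfold lastEnds
  split_ifs with h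
  · exact vertex_ne hm (by omega) (by omega) (by omega) le_rfl (by omega)
  · have := cut_lt π (s := len π - 2) (t := len π - 1) (by omega) (by omega)
    exact vertex_ne hm (cut_pos π (by omega)) (cut_le π _) (cut_pos π (by omega)) (cut_le π _)
      (by omega)

theorem arrow_cases (π : m.Partition) {d k : ℕ} (hk : k < arrows π d) :
    k < m - 1 ∨ (∃ t < len π - 1, k = m - 1 + t) ∨
      ∃ t < 2 * d, k = m - 1 + (len π - 1) + t := by
  unfold arrows at hk
  by_cases h1 : k < m - 1
  · exact Or.inl h1
  by_cases h2 : k < m - 1 + (len π - 1)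
  · exact Or.inr (Or.inl ⟨k - (m - 1), by omega, by omega⟩)
  · exact Or.inr (Or.inr ⟨k - (m - 1 + (len π - 1)), by omega, by omega⟩)

theorem loopless (hm : 2 ≤ m) (π : m.Partition) (d : ℕ) : (quiver hm π d).Loopless := by
  rintro ⟨k, hk⟩
  change vertex hm (ends π (k + 1)).1 ≠ vertex hm (ends π (k + 1)).2
  rcases arrow_cases π hk with h | ⟨t, ht, rfl⟩ | ⟨t, ht, rfl⟩
  · rw [ends_of_le π (by omega)]
    exact vertex_ne hm (by omega) (by omega) (by omega) (by omega) (by omega)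
  · rw [ends_middle π ht]
    have := cut_succ_lt π (t := t) (by omega)
    exact vertex_ne hm (cut_pos π (by omega)) (cut_le π _) (cut_pos π (by omega)) (cut_le π _)
      (by omega)
  · rw [ends_last]
    have := lastEnds_spec hm π
    split_ifs
    · exact this.symm
    · exact this

/-! ### Descending permutations and inverse arrows of the standard quiver -/

theorem descPerm_succ' (hm : 2 ≤ m) (π : m.Partition) (d : ℕ) {k : ℕ} (hk : k < arrows π d)
    (v : Fin m) : (quiver hm π d).descPerm (k + 1) v = (quiver hm π d).descPerm k
      (Equiv.swap (vertex hm (ends π (k + 1)).1) (vertex hm (ends π (k + 1)).2) v) :=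
  (quiver hm π d).descPerm_succ ⟨k, hk⟩ v

theorem descPerm_first (hm : 2 ≤ m) (π : m.Partition) (d : ℕ) {k : ℕ} (hk : k ≤ m - 1) {x : ℕ}
    (hx : 1 ≤ x) (hx' : x ≤ m) : (quiver hm π d).descPerm k (vertex hm x) =
      vertex hm (if x ≤ k then x + 1 else if x = k + 1 then 1 else x) := by
  induction k generalizing x with
  | zero =>
    rw [if_neg (by omega)]
    split_ifs with h
    · rw [h]; rfl
    · rfl
  | succ k ih =>
    have ih := fun {x} => ih (by omega) (x := x)
    rw [descPerm_succ' hm π d (by unfold arrows; omega), ends_of_le π hk]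
    simp only
    by_cases h1 : x = k + 1
    · rw [h1, Equiv.swap_apply_left, ih (by omega) (by omega), if_neg (by omega), if_neg (by omega),
        if_pos le_rfl]
    by_cases h2 : x = k + 2
    · rw [h2, Equiv.swap_apply_right, ih (by omega) (by omega), if_neg (by omega), if_pos rfl,
        if_neg (by omega), if_pos rfl]
    · rw [Equiv.swap_apply_of_ne_of_ne (vertex_ne hm hx hx' (by omega) (by omega) h1)
        (vertex_ne hm hx hx' (by omega) (by omega) h2), ih hx hx']
      congr 1
      split_ifs <;> omega

/-- The linear arrows give the m-cycle x ↦ x + 1; each further arrow v_t → v_{t+1} exchanges the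
images of its ends, splitting off a cycle and moving the preimage of 1 to v_{t+1}. -/
theorem descPerm_middle (hm : 2 ≤ m) (π : m.Partition) (d : ℕ) {t : ℕ} (ht : t ≤ len π - 1) :
    (quiver hm π d).descPerm (m - 1 + t) (vertex hm (cut π t)) = vertex hm 1 ∧
    (∀ s < t, (quiver hm π d).descPerm (m - 1 + t) (vertex hm (cut π s)) =
      vertex hm (cut π (s + 1) + 1)) ∧
    (∀ s, t < s → s < len π → (quiver hm π d).descPerm (m - 1 + t) (vertex hm (cut π s)) =
      vertex hm (cut π s + 1)) ∧
    (∀ x, 1 ≤ x → x ≤ m → (∀ s < len π, x ≠ cut π s) →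
      (quiver hm π d).descPerm (m - 1 + t) (vertex hm x) = vertex hm (x + 1)) := by
  have h0 := len_pos hm π
  induction t with
  | zero =>
    refine ⟨?_, fun s hs => by omega, fun s hs hs' => ?_, fun x hx hx' hn => ?_⟩
    · rw [cut_zero, add_zero, descPerm_first hm π d le_rfl (by omega) le_rfl, if_neg (by omega),
        if_pos (by omega)]
    · have := cut_lt_self π hs hs'
      rw [add_zero, descPerm_first hm π d le_rfl (cut_pos π hs') (cut_le π _), if_pos (by omega)]
    · have := hn 0 (by omega)
      rw [cut_zero] at this
      rw [add_zero, descPerm_first hm π d le_rfl hx hx', if_pos (by omega)]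
  | succ t ih =>
    obtain ⟨ih1, ih2, ih3, ih4⟩ := ih (by omega)
    have hne : ∀ {s s'}, s < len π → s' < len π → s ≠ s' →
        vertex hm (cut π s) ≠ vertex hm (cut π s') := fun hs hs' h =>
      vertex_ne hm (cut_pos π hs) (cut_le π _) (cut_pos π hs') (cut_le π _)
        fun e => h (cut_inj π hs hs' e)
    have hstep := descPerm_succ' hm π d (k := m - 1 + t) (by unfold arrows; omega)
    rw [ends_middle π (by omega)] at hstep
    simp only at hstep
    rw [← add_assoc]
    refine ⟨?_, fun s hs => ?_, fun s hs hs' => ?_, fun x hx hx' hn => ?_⟩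
    · rw [hstep, Equiv.swap_apply_right, ih1]
    · rcases Nat.lt_succ_iff_lt_or_eq.1 hs with h | h
      · rw [hstep, Equiv.swap_apply_of_ne_of_ne (hne (by omega) (by omega) (by omega))
          (hne (by omega) (by omega) (by omega)), ih2 s h]
      · rw [hstep, h, Equiv.swap_apply_left, ih3 _ (by omega) (by omega)]
    · rw [hstep, Equiv.swap_apply_of_ne_of_ne (hne (by omega) (by omega) (by omega))
          (hne (by omega) (by omega) (by omega)), ih3 s (by omega) hs']
    · rw [hstep, Equiv.swap_apply_of_ne_of_ne
        (vertex_ne hm hx hx' (cut_pos π (by omega)) (cut_le π _) (hn _ (by omega)))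
        (vertex_ne hm hx hx' (cut_pos π (by omega)) (cut_le π _) (hn _ (by omega))), ih4 x hx hx' hn]

/-- All the last arrows induce the same transposition, so only the parity of their number matters.
-/
theorem descPerm_last (hm : 2 ≤ m) (π : m.Partition) (d : ℕ) {t : ℕ} (ht : t ≤ 2 * d) (v : Fin m) :
    (quiver hm π d).descPerm (m - 1 + (len π - 1) + t) v =
      (quiver hm π d).descPerm (m - 1 + (len π - 1))
        (if Even t then v
          else Equiv.swap (vertex hm (lastEnds π).1) (vertex hm (lastEnds π).2) v) := by
  induction t generalizing v with
  | zero => simp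
  | succ t ih =>
    rw [← add_assoc, descPerm_succ' hm π d (by unfold arrows; omega), ih (by omega), ends_last]
    by_cases h : Even t
    · simp [h, Nat.even_add_one, Equiv.swap_comm]
    · simp [h, Nat.even_add_one]

theorem descPerm_arrows (hm : 2 ≤ m) (π : m.Partition) (d : ℕ) :
    (quiver hm π d).descPerm (arrows π d) (vertex hm (cut π (len π - 1))) = vertex hm 1 ∧
    (∀ s < len π - 1, (quiver hm π d).descPerm (arrows π d) (vertex hm (cut π s)) =
      vertex hm (cut π (s + 1) + 1)) ∧
    (∀ x, 1 ≤ x → x ≤ m → (∀ s < len π, x ≠ cut π s) →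
      (quiver hm π d).descPerm (arrows π d) (vertex hm x) = vertex hm (x + 1)) := by
  have h : ∀ v, (quiver hm π d).descPerm (arrows π d) v =
      (quiver hm π d).descPerm (m - 1 + (len π - 1)) v := by
    intro v
    have := descPerm_last hm π d le_rfl v
    rw [if_pos (even_two_mul d)] at this
    exact this
  obtain ⟨h1, h2, -, h4⟩ := descPerm_middle hm π d le_rfl
  simp only [h]
  exact ⟨h1, h2, h4⟩

theorem invCol_first (hm : 2 ≤ m) (π : m.Partition) (d : ℕ) {k : ℕ} (hk : k < m - 1)
    (hk' : k < arrows π d) (u : Fin m) : (quiver hm π d).invCol ⟨k, hk'⟩ u =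
      (if u = vertex hm 1 then 1 else 0) - (if u = vertex hm (k + 1 + 1) then 1 else 0) := by
  change (if u = (quiver hm π d).descPerm k (vertex hm (ends π (k + 1)).1) then (1 : ℤ) else 0) -
    (if u = (quiver hm π d).descPerm k (vertex hm (ends π (k + 1)).2) then 1 else 0) = _
  rw [ends_of_le π (by omega)]
  simp only
  rw [descPerm_first hm π d (by omega) (by omega) (by omega),
    descPerm_first hm π d (by omega) (by omega) (by omega),
    if_neg (show ¬ k + 1 ≤ k by omega), if_pos rfl, if_neg (show ¬ k + 1 + 1 ≤ k by omega),
    if_neg (show k + 1 + 1 ≠ k + 1 by omega)]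

theorem invCol_middle (hm : 2 ≤ m) (π : m.Partition) (d : ℕ) {t : ℕ} (ht : t < len π - 1)
    (hk' : m - 1 + t < arrows π d) (u : Fin m) : (quiver hm π d).invCol ⟨m - 1 + t, hk'⟩ u =
      (if u = vertex hm 1 then 1 else 0) -
        (if u = vertex hm (cut π (t + 1) + 1) then 1 else 0) := by
  change (if u = (quiver hm π d).descPerm (m - 1 + t) (vertex hm (ends π (m - 1 + t + 1)).1)
    then (1 : ℤ) else 0) - (if u = (quiver hm π d).descPerm (m - 1 + t)
      (vertex hm (ends π (m - 1 + t + 1)).2) then 1 else 0) = _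
  rw [ends_middle π ht]
  obtain ⟨h1, -, h3, -⟩ := descPerm_middle hm π d ht.le
  simp only
  rw [h1, h3 _ (by omega) (by omega)]

/-- The alternating orientation and the alternating power of the transposition compensate, so the
value does not depend on t. -/
theorem invCol_last (hm : 2 ≤ m) (π : m.Partition) (d : ℕ) {t : ℕ} (ht : t < 2 * d)
    (hk' : m - 1 + (len π - 1) + t < arrows π d) (u : Fin m) :
    (quiver hm π d).invCol ⟨m - 1 + (len π - 1) + t, hk'⟩ u =
      (if u = (quiver hm π d).descPerm (m - 1 + (len π - 1)) (vertex hm (lastEnds π).2)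
        then 1 else 0) -
      (if u = (quiver hm π d).descPerm (m - 1 + (len π - 1)) (vertex hm (lastEnds π).1)
        then 1 else 0) := by
  change (if u = (quiver hm π d).descPerm (m - 1 + (len π - 1) + t)
    (vertex hm (ends π (m - 1 + (len π - 1) + t + 1)).1) then (1 : ℤ) else 0) -
    (if u = (quiver hm π d).descPerm (m - 1 + (len π - 1) + t)
      (vertex hm (ends π (m - 1 + (len π - 1) + t + 1)).2) then 1 else 0) = _
  rw [ends_last, descPerm_last hm π d ht.le, descPerm_last hm π d ht.le]
  by_cases h : Even t <;> simp [h]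

/-! ### Columns of B and the two matrix products -/

theorem sum_alternating (d : ℕ) (z : ℤ) :
    ∑ t ∈ Finset.range (2 * d), (if Even (t + 1) then z else -z) = 0 := by
  induction d with
  | zero => simp
  | succ d ih =>
    rw [show 2 * (d + 1) = 2 * d + 1 + 1 by ring, Finset.sum_range_succ, Finset.sum_range_succ, ih]
    simp [Nat.even_add_one]

theorem mem_cuts (π : m.Partition) {x : ℕ} :
    x ∈ (Finset.Ico 1 (len π)).image (cut π) ↔ ∃ t, 1 ≤ t ∧ t < len π ∧ cut π t = x := by
  simp [and_assoc]

section Columns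

variable {n : ℕ} (hm : 2 ≤ m) (π : m.Partition) (d : ℕ) (a b : Fin m → Fin n → ℤ)

theorem col_first {k : ℕ} (hk : k < m - 1) : col hm π a b (k + 1) =
    if k + 1 ∈ (Finset.Ico 1 (len π)).image (cut π) then b (vertex hm (k + 1))
      else a (vertex hm (k + 1)) := by
  rw [col, if_pos (by omega)]

theorem col_middle {t : ℕ} (ht : t < len π - 1) : col hm π a b (m - 1 + t + 1) =
    a (vertex hm (cut π t)) - b (vertex hm (cut π (t + 1))) := by
  rw [col, if_neg (by omega), if_pos (by omega), yCol,
    show m - 1 + t + 1 - (m - 1) = t + 1 by omega, Nat.add_sub_cancel]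

/-- The common value, up to sign, of the last `2 d` columns. -/
def lastCol : Fin n → ℤ :=
  if len π = 1 then a (vertex hm (m - 1)) else yCol hm π a b (len π - 1)

theorem col_last (t : ℕ) : col hm π a b (m - 1 + (len π - 1) + t + 1) =
    if Even (t + 1) then lastCol hm π a b else - lastCol hm π a b := by
  rw [col, if_neg (by omega), if_neg (by omega)]
  simp only [lastCol]
  rw [show m - 1 + (len π - 1) + t + 1 - (m - 1 + (len π - 1)) = t + 1 by omega]

theorem mulVec_col (M : Matrix (Fin m) (Fin n) ℤ)
    (ha : ∀ v x, (M *ᵥ a v) x = (if x = v then 1 else 0) -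
      (if x = (quiver hm π d).descPerm (arrows π d) v then 1 else 0))
    (hb : ∀ t ∈ Finset.Ico 1 (len π), ∀ x, (M *ᵥ b (vertex hm (cut π t))) x =
      (if x = vertex hm (cut π t) then 1 else 0) - (if x = vertex hm (cut π t + 1) then 1 else 0))
    (k : Fin (arrows π d)) (x : Fin m) :
    (M *ᵥ col hm π a b (k + 1)) x = (quiver hm π d).incidence x k := by
  have h0 := len_pos hm π
  obtain ⟨-, hξ2, hξ3⟩ := descPerm_arrows hm π d
  have hy : ∀ t < len π - 1, (M *ᵥ (a (vertex hm (cut π t)) - b (vertex hm (cut π (t + 1))))) x =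
      (if x = vertex hm (cut π t) then 1 else 0) -
        (if x = vertex hm (cut π (t + 1)) then 1 else 0) := by
    intro t ht
    rw [Matrix.mulVec_sub, Pi.sub_apply, ha, hb (t + 1) (by simp; omega), hξ2 t ht]
    ring
  have hz : (M *ᵥ lastCol hm π a b) x = (if x = vertex hm (lastEnds π).1 then 1 else 0) -
      (if x = vertex hm (lastEnds π).2 then 1 else 0) := by
    by_cases h : len π = 1
    -- With a single part the only cut before the end is v_0 = m, so ξ sends m - 1 to m.
    · have hn : ∀ s < len π, m - 1 ≠ cut π s := by
        intro s hs
        rw [show s = 0 by omega, cut_zero]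
        omega
      simp only [lastCol, lastEnds, h, if_true]
      rw [ha, hξ3 _ (by omega) (by omega) hn, Nat.sub_add_cancel (by omega)]
    · have := hy (len π - 2) (by omega)
      rw [show len π - 2 + 1 = len π - 1 by omega] at this
      simp only [lastCol, lastEnds, h, if_false, yCol]
      exact this
  obtain ⟨k, hk⟩ := k
  change _ = (if x = vertex hm (ends π (k + 1)).1 then (1 : ℤ) else 0) -
    (if x = vertex hm (ends π (k + 1)).2 then 1 else 0)
  rcases arrow_cases π hk with h | ⟨t, ht, rfl⟩ | ⟨t, ht, rfl⟩
  · rw [col_first hm π a b h, ends_of_le π (by omega)]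
    by_cases hc : k + 1 ∈ (Finset.Ico 1 (len π)).image (cut π)
    · obtain ⟨t, h1, h2, h3⟩ := (mem_cuts π).1 hc
      rw [if_pos hc, ← h3]
      exact hb t (by simp; omega) x
    · rw [if_neg hc, ha, hξ3 _ (by omega) (by omega)]
      intro s hs he
      rcases Nat.eq_zero_or_pos s with h4 | h4
      · rw [h4, cut_zero] at he; omega
      · exact hc ((mem_cuts π).2 ⟨s, h4, hs, he.symm⟩)
  · rw [col_middle hm π a b ht, ends_middle π ht]
    exact hy t ht
  · rw [col_last, ends_last]
    by_cases h : Even t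
    · simp [h, Nat.even_add_one, Matrix.mulVec_neg, hz]
    · simp [h, Nat.even_add_one, hz]

theorem sum_labels (f : Fin m → ℤ) : ∑ v, f v = ∑ k ∈ Finset.range m, f (vertex hm (k + 1)) := by
  rw [← Fin.sum_univ_eq_sum_range fun k => f (vertex hm (k + 1))]
  exact Finset.sum_congr rfl fun v _ => by rw [vertex_succ]

theorem sum_range_cuts (f : ℕ → ℤ) :
    ∑ k ∈ Finset.range (m - 1),
      (if k + 1 ∈ (Finset.Ico 1 (len π)).image (cut π) then f (k + 1) else 0) =
    ∑ t ∈ Finset.range (len π - 1), f (cut π (t + 1)) := by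
  have h1 := Finset.sum_Ico_eq_sum_range
    (fun x => if x ∈ (Finset.Ico 1 (len π)).image (cut π) then f x else 0) 1 m
  have h2 := Finset.sum_Ico_eq_sum_range (fun t => f (cut π t)) 1 (len π)
  simp only [add_comm 1] at h1 h2
  rw [← h1, ← h2, ← Finset.sum_filter, Finset.filter_mem_eq_inter, Finset.inter_eq_right.2,
    Finset.sum_image]
  · intro s hs t ht h
    simp at hs ht
    exact cut_inj π hs.2 ht.2 h
  · intro x hx
    obtain ⟨t, ht1, ht2, rfl⟩ := (mem_cuts π).1 hx
    have := cut_pos π ht2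
    have := cut_lt_self π ht1 ht2
    simp
    omega

theorem sum_col_mul_invCol (i : Fin n) (u : Fin m) :
    ∑ k : Fin (arrows π d), col hm π a b (k + 1) i * (quiver hm π d).invCol k u =
      ∑ v, a v i * ((if u = vertex hm 1 then 1 else 0) -
        (if u = (quiver hm π d).descPerm (arrows π d) v then 1 else 0)) := by
  have h0 := len_pos hm π
  obtain ⟨hξ1, hξ2, hξ3⟩ := descPerm_arrows hm π d
  let g : ℕ → ℤ := fun k => if h : k < arrows π d then (quiver hm π d).invCol ⟨k, h⟩ u else 0
  let e : ℕ → ℤ := fun x => (if u = vertex hm 1 then 1 else 0) - (if u = vertex hm x then 1 else 0)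
  let G : Fin m → ℤ := fun v => a v i * ((if u = vertex hm 1 then 1 else 0) -
        (if u = (quiver hm π d).descPerm (arrows π d) v then 1 else 0))
  let D : ℕ → ℤ := fun x => b (vertex hm x) i * e (x + 1)
  have hsum : ∑ k : Fin (arrows π d), col hm π a b (k + 1) i * (quiver hm π d).invCol k u =
      ∑ k ∈ Finset.range (arrows π d), col hm π a b (k + 1) i * g k := by
    rw [← Fin.sum_univ_eq_sum_range fun k => col hm π a b (k + 1) i * g k]
    exact Finset.sum_congr rfl fun k _ => by simp [g]
  -- Every linear arrow is counted with its `a`-term G, then corrected at the cuts, where the column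
  -- is d_t instead.
  have h1 : ∑ k ∈ Finset.range (m - 1), col hm π a b (k + 1) i * g k =
      ∑ k ∈ Finset.range (m - 1), G (vertex hm (k + 1)) +
      ∑ t ∈ Finset.range (len π - 1), (D (cut π (t + 1)) - G (vertex hm (cut π (t + 1)))) := by
    rw [← sum_range_cuts π fun x => D x - G (vertex hm x), ← Finset.sum_add_distrib]
    refine Finset.sum_congr rfl fun k hk => ?_
    have hk := Finset.mem_range.1 hk
    have hk' : k < arrows π d := by unfold arrows; omega
    have hg : g k = e (k + 1 + 1) := by
      simp only [g, dif_pos hk', e]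
      exact invCol_first hm π d hk hk' u
    rw [hg, col_first hm π a b hk]
    split_ifs with hc
    · simp [D]
    · rw [add_zero]
      simp only [G, e]
      rw [hξ3 _ (by omega) (by omega)]
      intro s hs he
      rcases Nat.eq_zero_or_pos s with h4 | h4
      · rw [h4, cut_zero] at he; omega
      · exact hc ((mem_cuts π).2 ⟨s, h4, hs, he.symm⟩)
  -- Because ξ(v_t) = v_{t+1} + 1, the part of y_{t+1} coming from a is again a G-term, and its
  -- d-part cancels D in `h1`.
  have h2 : ∑ t ∈ Finset.range (len π - 1), col hm π a b (m - 1 + t + 1) i * g (m - 1 + t) =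
      ∑ t ∈ Finset.range (len π - 1), (G (vertex hm (cut π t)) - D (cut π (t + 1))) := by
    refine Finset.sum_congr rfl fun t ht => ?_
    have ht := Finset.mem_range.1 ht
    have hk' : m - 1 + t < arrows π d := by unfold arrows; omega
    have hg : g (m - 1 + t) = e (cut π (t + 1) + 1) := by
      simp only [g, dif_pos hk', e]
      exact invCol_middle hm π d ht hk' u
    rw [hg, col_middle hm π a b ht]
    simp only [G, D, hξ2 t ht, Pi.sub_apply, e]
    ring
  have h3 : ∑ t ∈ Finset.range (2 * d), col hm π a b (m - 1 + (len π - 1) + t + 1) i *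
      g (m - 1 + (len π - 1) + t) = 0 := by
    let p := (quiver hm π d).descPerm (m - 1 + (len π - 1))
    rw [Finset.sum_congr rfl (g := fun t => (if Even (t + 1) then lastCol hm π a b i
      else - lastCol hm π a b i) * ((if u = p (vertex hm (lastEnds π).2) then 1 else 0) -
        (if u = p (vertex hm (lastEnds π).1) then 1 else 0))) fun t ht => ?_,
      ← Finset.sum_mul, sum_alternating, zero_mul]
    have ht := Finset.mem_range.1 ht
    have hk' : m - 1 + (len π - 1) + t < arrows π d := by unfold arrows; omega
    simp only [g, dif_pos hk']
    rw [invCol_last hm π d ht hk' u, col_last]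
    split_ifs <;> rfl
  -- The last cut is sent to 1 by ξ, which closes the index shift between v_t and v_{t+1} in `h4`.
  have hG : G (vertex hm (cut π (len π - 1))) = 0 := by
    simp [G, hξ1]
  have h4 : ∑ t ∈ Finset.range (len π - 1), G (vertex hm (cut π t)) =
      G (vertex hm m) + ∑ t ∈ Finset.range (len π - 1), G (vertex hm (cut π (t + 1))) := by
    have h5 := Finset.sum_range_succ (fun t => G (vertex hm (cut π t))) (len π - 1)
    have h6 := Finset.sum_range_succ' (fun t => G (vertex hm (cut π t))) (len π - 1)
    rw [cut_zero] at h6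
    linarith
  have h5 : ∑ v, G v = ∑ k ∈ Finset.range (m - 1), G (vertex hm (k + 1)) + G (vertex hm m) := by
    have := Finset.sum_range_succ (fun k => G (vertex hm (k + 1))) (m - 1)
    rwa [Nat.sub_add_cancel (by omega), ← sum_labels hm] at this
  change _ = ∑ v, G v
  rw [hsum, arrows, Finset.sum_range_add, Finset.sum_range_add, h3, h1, h2, h5,
    Finset.sum_sub_distrib, Finset.sum_sub_distrib, h4]
  ring

end Columns

/-! ### Both equations for B, and existence of B -/

theorem IsStructuralMatrix.equations (hm : 2 ≤ m) {d : ℕ} {π : m.Partition}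
    {Q : FinQuiver m (arrows π d)} (hl : Q.Loopless)
    (hΛ : Q.coxeterLaplacian = (quiver hm π d).coxeterLaplacian)
    {B : Matrix (Fin (arrows π d)) (Fin (arrows π d)) ℤ} (hB : IsStructuralMatrix hm π Q B) :
    Q.incidence * B = (quiver hm π d).incidence ∧
      (quiver hm π d).inverse.incidence * Bᵀ = Q.inverse.incidence := by
  have hξ : ∀ v, Q.descPerm (arrows π d) v = (quiver hm π d).descPerm (arrows π d) v := by
    intro v
    have h := congrFun (congrFun hΛ (Q.descPerm (arrows π d) v)) v
    rw [Q.coxeterLaplacian_apply hl, coxeterLaplacian_apply _ (loopless hm π d), if_pos rfl] at h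
    by_contra hne
    rw [if_neg hne] at h
    exact one_ne_zero h
  obtain ⟨α, δ, hα, hδ, hcol⟩ := hB
  have hα' : ∀ v, α v = Q.descWalk (arrows π d) v := fun v => by
    obtain ⟨x, hx⟩ := hα v
    exact (hx.eq_descWalk hl).1
  constructor
  · ext x k
    rw [← mulVec_col hm π d (fun v => inc (α v)) (fun v => inc (δ v)) Q.incidence]
    · rw [Matrix.mul_apply]
      exact Finset.sum_congr rfl fun i _ => by rw [hcol]
    · intro v x
      rw [← hξ, hα']
      exact Q.incidence_mulVec_inc (Q.isWalk_descWalk _ v) x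
    · intro t ht x
      exact Q.incidence_mulVec_inc (hδ t ht) x
  · ext u i
    -- Rows are indexed through ξ, the form in which `invCol_descPerm` gives the entries.
    obtain ⟨v, rfl⟩ := (Q.descPerm (arrows π d)).surjective u
    rw [Q.inverse_incidence_apply hl, Q.invCol_descPerm hl, Matrix.mul_apply]
    have h1 := sum_col_mul_invCol hm π d (fun v => inc (α v)) (fun v => inc (δ v)) i
      (Q.descPerm (arrows π d) v)
    simp only [hα', ← hξ, mul_sub, Finset.sum_sub_distrib, ← Finset.sum_mul,
      Q.sum_inc_descWalk hl, (Q.descPerm (arrows π d)).injective.eq_iff] at h1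
    simp only [mul_ite, mul_one, mul_zero, ite_self, Finset.sum_ite_eq, Finset.mem_univ, if_true,
      zero_sub] at h1
    refine Eq.trans ?_ h1
    refine Finset.sum_congr rfl fun k _ => ?_
    rw [inverse_incidence_apply _ (loopless hm π d), Matrix.transpose_apply, hcol, mul_comm]
    simp only [hα']

theorem exists_isStructuralMatrix (hm : 2 ≤ m) {d : ℕ} (π : m.Partition)
    (Q : FinQuiver m (arrows π d)) (hconn : Q.Connected) (hl : Q.Loopless) :
    ∃ B, IsStructuralMatrix hm π Q B := by
  choose w hw using hconn
  -- The zero-based vertex v has label v + 1, so the walk at v must end at label v + 1 + 1;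
  -- connectedness supplies it.
  refine ⟨Matrix.of fun i k => col hm π (fun v => inc (Q.descWalk (arrows π d) v))
    (fun v => inc (w v (vertex hm (v + 1 + 1)))) (k + 1) i, fun v => Q.descWalk (arrows π d) v,
    fun v => w v (vertex hm (v + 1 + 1)), fun v => ⟨_, Q.isStructural_descWalk hl v⟩,
    fun t ht => ?_, fun i k => rfl⟩
  have ht := Finset.mem_Ico.1 ht
  have h1 := cut_pos π ht.2
  have h2 := cut_le π t
  have h3 : ((vertex hm (cut π t) : Fin m) : ℕ) + 1 = cut π t := by
    simp only [vertex]
    rw [Nat.mod_eq_of_lt (by omega)]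
    omega
  simp only [h3]
  exact hw _ _

end StandardQuiver

theorem mainTheorem5 {m : ℕ} (hm : 2 ≤ m) (π : m.Partition) (d : ℕ)
    (Q : FinQuiver m (StandardQuiver.arrows π d)) (hconn : Q.Connected) (hloop : Q.Loopless)
    (hΛ : Q.coxeterLaplacian = (StandardQuiver.quiver hm π d).coxeterLaplacian) :
    (Q.inverse.incidence = Q.incidence * Q.upperGram⁻¹ ∧
      (StandardQuiver.quiver hm π d).inverse.incidence =
        (StandardQuiver.quiver hm π d).incidence * (StandardQuiver.quiver hm π d).upperGram⁻¹) ∧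
    (∃ B : Matrix (Fin (StandardQuiver.arrows π d)) (Fin (StandardQuiver.arrows π d)) ℤ,
      StandardQuiver.IsStructuralMatrix hm π Q B ∧
      Q.incidence * B = (StandardQuiver.quiver hm π d).incidence ∧
      (StandardQuiver.quiver hm π d).inverse.incidence * Bᵀ = Q.inverse.incidence) ∧
    (∀ B : Matrix (Fin (StandardQuiver.arrows π d)) (Fin (StandardQuiver.arrows π d)) ℤ,
      StandardQuiver.IsStructuralMatrix hm π Q B →
      Q.incidence * B = (StandardQuiver.quiver hm π d).incidence ∧
      (StandardQuiver.quiver hm π d).inverse.incidence * Bᵀ = Q.inverse.incidence) := by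
  obtain ⟨B, hB⟩ := StandardQuiver.exists_isStructuralMatrix hm π Q hconn hloop
  exact ⟨⟨Q.inverse_incidence hloop,
      FinQuiver.inverse_incidence _ (StandardQuiver.loopless hm π d)⟩,
    ⟨B, hB, hB.equations hm hloop hΛ⟩, fun _ hB' => hB'.equations hm hloop hΛ⟩
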